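/- For integers $m,n\ge 1$ let $S_{m,n}$ be the set of words that use each of the letters $1,\dots,n$ exactly $m$ times (and no other letter). For $\pi\in S_{m,n}$ let $L^1_{m,n}(\pi)$ be the length of the longest (not necessarily contiguous) subsequence of $\pi$ of the form $1\,2\,3\cdots j$. Expectations below are over $\pi$ chosen uniformly at random from $S_{m,n}$. (a) For every integer $m\ge 1$, the limit $\mathcal{L}^1_m:=\lim_{n\to\infty}\mathbb{E}[L^1_{m,n}(\pi)]$ exists, and $$\mathcal{L}^1_m=-1-\sum_{i=1}^m \alpha_i^{-1}e^{-\alpha_i},$$ where $\alpha_1,\dots,\alpha_m$ are the complex zeros of $E_m(x)=\sum_{k=0}^m \frac{x^k}{k!}$, listed with multiplicity. (b) There are absolute constants $\beta>0$ and $C$ such that for every integer $m\ge 1$, $$\left|\mathcal{L}^1_m-\left(m+1-\frac1{m+2}\right)\right|\le C e^{-\beta m}.$$ In particular, as conjectured by Diaconis, Graham, He and Spiro, $\mathbb{E}[L^1_{m,n}(\pi)]\sim m$ as $m\to\infty$ if $n$ is sufficiently large in terms of $m$: for every $\varepsilon>0$ there is $M\ge 1$ such that for every $m\ge M$ there is $N$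 such that $\left|\mathbb{E}[L^1_{m,n}(\pi)]/m-1\right|\le\varepsilon$ for all $n\ge N$. -/

import Mathlib

/-- The set `S_{m,n}` of words over the letters `1, …, n` using each letter exactly `m` times. -/
def multisetPerms (m n : ℕ) : Finset (List ℕ) :=
  (m • (Finset.Icc 1 n).val).lists.toFinset

/-- A word is in `S_{m,n}` exactly when each of `1, …, n` occurs `m` times and nothing else occurs. -/
theorem mem_multisetPerms {m n : ℕ} {w : List ℕ} :
    w ∈ multisetPerms m n ↔ ∀ a : ℕ, w.count a = if a ∈ Finset.Icc 1 n then m else 0 := by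
  rw [multisetPerms, Multiset.mem_toFinset, Multiset.mem_lists_iff, Multiset.quot_mk_to_coe, Multiset.ext]
  refine forall_congr' fun a => ?_
  rw [Multiset.count_nsmul, Multiset.coe_count,
    Multiset.count_eq_of_nodup (Finset.Icc 1 n).nodup, eq_comm]
  simp only [Finset.mem_val, mul_ite, mul_one, mul_zero]

/-- `L^i(w)`: the largest `k` such that the word `i (i+1) ⋯ (i+k-1)` is a (not necessarily
contiguous) subsequence of `w`. Such a `k` is at most the length of `w`, so the
search bound loses nothing. -/
def contIncLength (i : ℕ) (w : List ℕ) : ℕ :=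
  Nat.findGreatest (fun k => (List.range' i k).Sublist w) w.length

/-- The expectation of `L^1_{m,n}(π)` for `π` uniform in `S_{m,n}`. -/
noncomputable def expectedL1 (m n : ℕ) : ℝ :=
  (multisetPerms m n).expect fun w => (contIncLength 1 w : ℝ)

/-- The truncated exponential polynomial `E_m(x) = ∑_{k=0}^m x^k / k!`, over `ℂ`. -/
noncomputable def truncExp (m : ℕ) : Polynomial ℂ :=
  ∑ k ∈ Finset.range (m + 1), Polynomial.monomial k ((k.factorial : ℂ)⁻¹)

/-!
Give every occurrence of every letter an independent uniform position in `[0, 1]`. Reading the word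
greedily, the waiting time from the first suitable `k` to the next `k + 1` has tail `(1 - x) ^ m`,
independently of the past, so `1 2 ⋯ k` is a subsequence with probability `P(X_1 + ⋯ + X_k ≤ 1)`
for independent steps `X_i` of density `m (1 - x) ^ (m - 1)`. Hence the expectations converge to
`U(1) - 1`, where `U` is the renewal function of these steps.

The proof replaces the continuous model by algebra. `wordCount_eq` counts the words of any content
that contain a given repetition-free subsequence, by induction on the first letter; the answer is
`borelEval` (`X ^ j ↦ 1 / j!`) of a product with one factor for each letter. For `1 2 ⋯ k` the
probability becomes `borelEval (g ^ k)` with `g = m! * markedFactor m`, whatever `n ≥ k` is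
(`expectedL1_eq_sum`). The polynomial `1 - g` is `E_m(-X)` reversed and normalised, its inverse is the
sum of `-α⁻¹ / (1 + α X)` over the zeros `α` of `E_m` (`one_sub_mul_zeroSeries`), and the functional
turns this into `U(1) = -∑ α⁻¹ e^{-α}` (`tendsto_sum_borelEval`). The partial fractions rest on the
negative power sums of the zeros, which Lagrange interpolation gives because
`E_m'(α) = -α ^ m / m!` (`zeroPowerSum_neg`).

For the precise estimate, let `v(t) = ∑ e^{-α t} - (m + 1)` be the deviation of the renewal density
from its asymptotic value. The same power sums show that `∫_0^1 t ^ (m + 1) v(t) dt` is exactly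
`U(1) - (m + 2 - 1 / (m + 2))` (`integral_moment_densityDeviation`), and that `v` satisfies a
convolution equation with kernel `m x (1 - x) ^ (m - 1)`, of mass `O(1 / m)` even with the weight
`e^{m x / 2}` (`densityDeviation_eq`, `kernel_le`). So `v(t) = O(e^{-m t / 2})` uniformly in large `m`
(`norm_densityDeviation_le`), and the moment is `O(e^{-m / 2})`.
-/

open Polynomial

/-! ### The Borel functional and the factor attached to a letter -/

/-- The linear functional on `ℂ[X]` sending `X ^ j` to `1 / j!`. -/
noncomputable def borelEval : ℂ[X] →ₗ[ℂ] ℂ :=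
  Polynomial.lsum fun j => ((j.factorial : ℂ)⁻¹) • LinearMap.id

theorem borelEval_apply (p : ℂ[X]) :
    borelEval p = p.sum fun j a => (j.factorial : ℂ)⁻¹ * a := by
  simp [borelEval, Polynomial.lsum_apply]

theorem borelEval_monomial (j : ℕ) (a : ℂ) :
    borelEval (monomial j a) = (j.factorial : ℂ)⁻¹ * a := by
  rw [borelEval_apply, Polynomial.sum_monomial_index _ _ (by simp)]

theorem borelEval_C_mul (a : ℂ) (p : ℂ[X]) : borelEval (C a * p) = a * borelEval p := by
  rw [← Polynomial.smul_eq_C_mul, map_smul, smul_eq_mul]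

/-- Under the Borel functional the Euler operator `X · d/dX` undoes multiplication by `X`,
since `j / j! = 1 / (j - 1)!`. -/
theorem borelEval_euler (q : ℂ[X]) :
    borelEval (X * derivative (X * q)) = borelEval q := by
  induction q using Polynomial.induction_on' with
  | add p q hp hq => simp only [mul_add, map_add, hp, hq]
  | monomial n a =>
    have h : (X : ℂ[X]) * derivative (X * monomial n a) = monomial (n + 1) (a * (n + 1)) := by
      rw [X_mul_monomial, derivative_monomial, X_mul_monomial]; simp
    rw [h, borelEval_monomial, borelEval_monomial, Nat.factorial_succ]
    have h1 : (n.factorial : ℂ) ≠ 0 := by exact_mod_cast n.factorial_ne_zero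
    have h2 : (n + 1 : ℂ) ≠ 0 := by exact_mod_cast n.succ_ne_zero
    push_cast
    field_simp

/-- The polynomial `∑_{j=1}^c (-1)^(j-1) X^j / (c-j)!`, which accounts for a letter that occurs `c`
times in a word and is required to appear at its place in a prescribed subsequence. -/
noncomputable def markedFactor : ℕ → ℂ[X]
  | 0 => 0
  | c + 1 => X * (C ((c.factorial : ℂ)⁻¹) - markedFactor c)

theorem X_mul_derivative_markedFactor (c : ℕ) :
    X * derivative (markedFactor c) = (c : ℂ[X]) * markedFactor c - markedFactor (c - 1) := by
  induction c with
  | zero => simp [markedFactor]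
  | succ c ih =>
    have key : (c : ℂ[X]) * X * C ((c.factorial : ℂ)⁻¹) - markedFactor c
        = X * markedFactor (c - 1) := by
      cases c with
      | zero => simp [markedFactor]
      | succ d =>
        have h : (((d + 1 : ℕ)) : ℂ[X]) * C (((d + 1).factorial : ℂ)⁻¹)
            = C ((d.factorial : ℂ)⁻¹) := by
          rw [← C_eq_natCast, ← C_mul, Nat.factorial_succ]
          have h1 : ((d + 1 : ℕ) : ℂ) ≠ 0 := by exact_mod_cast d.succ_ne_zero
          congr 1
          push_cast at h1 ⊢
          field_simp
        simp only [markedFactor, Nat.add_sub_cancel]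
        rw [mul_right_comm, h]; ring
    have e : X * derivative (markedFactor (c + 1))
        = markedFactor (c + 1) - X * (X * derivative (markedFactor c)) := by
      simp only [markedFactor, derivative_mul, derivative_X, derivative_sub, derivative_C]
      ring
    rw [e, ih, Nat.add_sub_cancel]
    push_cast
    have e2 : markedFactor (c + 1) = X * (C ((c.factorial : ℂ)⁻¹) - markedFactor c) := rfl
    rw [e2]
    linear_combination -key

/-- The factor contributed by a letter with `c` occurrences: `markedFactor c` if the letter belongs
to the prescribed subsequence, and the constant `1 / c!` otherwise. -/
noncomputable def letterFactor (marked : Prop) [Decidable marked] (c : ℕ) : ℂ[X] :=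
  if marked then markedFactor c else C ((c.factorial : ℂ)⁻¹)

theorem letterFactor_pred (marked : Prop) [Decidable marked] {c : ℕ} (hc : c ≠ 0) :
    letterFactor marked (c - 1)
      = (c : ℂ[X]) * letterFactor marked c - X * derivative (letterFactor marked c) := by
  unfold letterFactor
  split_ifs
  · rw [X_mul_derivative_markedFactor]; ring
  · obtain ⟨d, rfl⟩ := Nat.exists_eq_succ_of_ne_zero hc
    have h1 : ((d + 1 : ℕ) : ℂ) ≠ 0 := by exact_mod_cast d.succ_ne_zero
    rw [derivative_C, mul_zero, sub_zero, ← C_eq_natCast, ← C_mul, Nat.succ_sub_one,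
      Nat.succ_eq_add_one, Nat.factorial_succ]
    congr 1
    push_cast at h1 ⊢
    field_simp

theorem letterFactor_zero (marked : Prop) [Decidable marked] :
    X * derivative (letterFactor marked 0) = 0 := by
  unfold letterFactor
  split_ifs <;> simp [markedFactor]

/-! ### Counting words with a prescribed subsequence -/

/-- The number of words with content `M` (letters with multiplicities) that contain `l` as a
subsequence. -/
def wordCount (M : Multiset ℕ) (l : List ℕ) : ℕ :=
  (M.lists.toFinset.filter fun w => l.Sublist w).card

theorem mem_lists_iff_coe_eq {M : Multiset ℕ} {w : List ℕ} :
    w ∈ M.lists ↔ (w : Multiset ℕ) = M := by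
  rw [Multiset.mem_lists_iff, eq_comm]; rfl

/-- Sorting the words of a given content by their first letter. -/
theorem card_filter_lists {M : Multiset ℕ} (hM : M ≠ 0) (p : List ℕ → Prop) [DecidablePred p] :
    (M.lists.toFinset.filter p).card
      = ∑ b ∈ M.toFinset, ((M.erase b).lists.toFinset.filter fun w => p (b :: w)).card := by
  have h : M.lists.toFinset.filter p = M.toFinset.biUnion fun b =>
      ((M.erase b).lists.toFinset.filter fun w => p (b :: w)).image (List.cons b) := by
    ext w
    simp only [Finset.mem_filter, Multiset.mem_toFinset, mem_lists_iff_coe_eq, Finset.mem_biUnion,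
      Finset.mem_image]
    constructor
    · rintro ⟨rfl, hp⟩
      cases w with
      | nil => exact absurd rfl hM
      | cons b w => exact ⟨b, by simp, w, ⟨by simp, hp⟩, rfl⟩
    · rintro ⟨b, hb, w, ⟨hw, hp⟩, rfl⟩
      refine ⟨?_, hp⟩
      rw [← Multiset.cons_coe, hw, Multiset.cons_erase hb]
  rw [h, Finset.card_biUnion]
  · refine Finset.sum_congr rfl fun b _ => ?_
    exact Finset.card_image_of_injective _ List.cons_injective
  · intro b _ c _ hbc
    rw [Function.onFun, Finset.disjoint_left]
    intro w hw hw'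
    simp only [Finset.mem_image] at hw hw'
    obtain ⟨w1, _, rfl⟩ := hw
    obtain ⟨w2, _, h2⟩ := hw'
    exact hbc (List.cons_eq_cons.mp h2).1.symm

theorem wordCount_nil {M : Multiset ℕ} (hM : M ≠ 0) :
    wordCount M [] = ∑ b ∈ M.toFinset, wordCount (M.erase b) [] := by
  unfold wordCount
  rw [card_filter_lists hM]
  simp

theorem wordCount_cons {M : Multiset ℕ} (hM : M ≠ 0) (a : ℕ) (l : List ℕ) :
    wordCount M (a :: l) = ∑ b ∈ M.toFinset,
      if b = a then wordCount (M.erase b) l else wordCount (M.erase b) (a :: l) := by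
  unfold wordCount
  rw [card_filter_lists hM]
  refine Finset.sum_congr rfl fun b _ => ?_
  split_ifs with h
  · subst h; simp only [List.cons_sublist_cons]
  · congr 1
    refine Finset.filter_congr fun w _ => ?_
    rw [List.cons_sublist_cons']
    simp [Ne.symm h]

/-- The product of the factors of the letters in `S`, for words with content `M` and prescribed
subsequence `l`. -/
noncomputable def contentPoly (S : Finset ℕ) (M : Multiset ℕ) (l : List ℕ) : ℂ[X] :=
  ∏ i ∈ S, letterFactor (i ∈ l) (M.count i)

theorem contentPoly_erase {S : Finset ℕ} {M : Multiset ℕ} (l : List ℕ) {b : ℕ} (hb : b ∈ S) :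
    contentPoly S (M.erase b) l
      = letterFactor (b ∈ l) (M.count b - 1)
        * ∏ i ∈ S.erase b, letterFactor (i ∈ l) (M.count i) := by
  rw [contentPoly, ← Finset.mul_prod_erase S _ hb, Multiset.count_erase_self]
  congr 1
  refine Finset.prod_congr rfl fun i hi => ?_
  rw [Multiset.count_erase_of_ne (Finset.ne_of_mem_erase hi)]

/-- Removing one letter in all possible ways: the Euler operator measures the defect from
multiplication by the length. -/
theorem sum_contentPoly_erase {S : Finset ℕ} {M : Multiset ℕ} (hS : M.toFinset ⊆ S)
    (l : List ℕ) :
    ∑ b ∈ M.toFinset, contentPoly S (M.erase b) l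
      = (M.card : ℂ[X]) * contentPoly S M l - X * derivative (contentPoly S M l) := by
  have h1 : ∑ b ∈ M.toFinset, contentPoly S (M.erase b) l
      = ∑ b ∈ S, ((M.count b : ℂ[X]) * letterFactor (b ∈ l) (M.count b)
          - X * derivative (letterFactor (b ∈ l) (M.count b)))
          * ∏ i ∈ S.erase b, letterFactor (i ∈ l) (M.count i) := by
    rw [← Finset.sum_subset hS]
    · refine Finset.sum_congr rfl fun b hb => ?_
      rw [contentPoly_erase l (hS hb), letterFactor_pred]
      exact Multiset.count_ne_zero.mpr (Multiset.mem_toFinset.mp hb)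
    · intro b _ hb
      rw [Multiset.count_eq_zero_of_notMem (by simpa using hb), letterFactor_zero]
      simp
  have h2 : (M.card : ℂ[X]) = ∑ b ∈ S, (M.count b : ℂ[X]) := by
    rw [← Finset.sum_subset hS, ← Nat.cast_sum, Multiset.toFinset_sum_count_eq]
    intro b _ hb
    rw [Multiset.count_eq_zero_of_notMem (by simpa using hb), Nat.cast_zero]
  rw [h1, h2, contentPoly, derivative_prod_finset, Finset.sum_mul, Finset.mul_sum,
    ← Finset.sum_sub_distrib]
  refine Finset.sum_congr rfl fun b hb => ?_
  rw [← Finset.mul_prod_erase S (fun i => letterFactor (i ∈ l) (M.count i)) hb]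
  ring

theorem derivative_contentPoly_nil (S : Finset ℕ) (M : Multiset ℕ) :
    derivative (contentPoly S M []) = 0 := by
  rw [contentPoly, derivative_prod_finset]
  exact Finset.sum_eq_zero fun i _ => by simp [letterFactor]

/-- The recursion `markedFactor (c + 1) = X * (1 / c! - markedFactor c)` read on contents: the two
terms are the words whose first letter `a` is, or is not, used for the prescribed subsequence. -/
theorem borelEval_euler_contentPoly {S : Finset ℕ} {M : Multiset ℕ} {a : ℕ} {l : List ℕ}
    (ha : a ∈ S) (hal : a ∉ l) :
    borelEval (X * derivative (contentPoly S M (a :: l)))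
      = if a ∈ M then borelEval (contentPoly S (M.erase a) l)
          - borelEval (contentPoly S (M.erase a) (a :: l)) else 0 := by
  have h : contentPoly S M (a :: l)
      = markedFactor (M.count a) * ∏ i ∈ S.erase a, letterFactor (i ∈ l) (M.count i) := by
    rw [contentPoly, ← Finset.mul_prod_erase S _ ha]
    congr 1
    · simp [letterFactor]
    · refine Finset.prod_congr rfl fun i hi => ?_
      simp [letterFactor, Finset.ne_of_mem_erase hi]
  split_ifs with hM
  · obtain ⟨c, hc⟩ := Nat.exists_eq_succ_of_ne_zero (Multiset.count_ne_zero.mpr hM)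
    rw [h, contentPoly_erase l ha, contentPoly_erase (a :: l) ha, hc]
    have h' : ∏ i ∈ S.erase a, letterFactor (i ∈ a :: l) (M.count i)
        = ∏ i ∈ S.erase a, letterFactor (i ∈ l) (M.count i) :=
      Finset.prod_congr rfl fun i hi => by simp [letterFactor, Finset.ne_of_mem_erase hi]
    rw [h', Nat.succ_eq_add_one, markedFactor, mul_assoc, borelEval_euler, ← map_sub]
    congr 1
    simp [letterFactor, hal, sub_mul]
  · rw [h, Multiset.count_eq_zero_of_notMem hM]
    simp [markedFactor]

/-- The number of words with content `M` that contain the repetition-free word `l` as a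
subsequence. -/
theorem wordCount_eq {S : Finset ℕ} {M : Multiset ℕ} (hS : M.toFinset ⊆ S) {l : List ℕ}
    (hl : l.Nodup) (hlS : ∀ i ∈ l, i ∈ S) :
    (wordCount M l : ℂ) = (M.card.factorial : ℂ) * borelEval (contentPoly S M l) := by
  induction hn : M.card generalizing M l with
  | zero =>
    obtain rfl := Multiset.card_eq_zero.mp hn
    have h0 : (0 : Multiset ℕ).lists.toFinset = {[]} := by
      ext w; rw [Multiset.mem_toFinset, mem_lists_iff_coe_eq, Finset.mem_singleton, Multiset.coe_eq_zero]
    cases l with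
    | nil =>
      have : contentPoly S 0 [] = monomial 0 1 := by
        simp [contentPoly, letterFactor]
      rw [this, borelEval_monomial, wordCount, h0]; simp [Finset.filter_singleton]
    | cons a l =>
      have : contentPoly S 0 (a :: l) = 0 :=
        Finset.prod_eq_zero (hlS a (by simp)) (by simp [letterFactor, markedFactor])
      rw [this, wordCount, h0]; simp [Finset.filter_singleton]
  | succ n ih =>
    have hM : M ≠ 0 := by rintro rfl; simp at hn
    have hsub : ∀ b, (M.erase b).toFinset ⊆ S := fun b x hx =>
      hS (Multiset.mem_toFinset.mpr (Multiset.mem_of_mem_erase (Multiset.mem_toFinset.mp hx)))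
    have hcard : ∀ b ∈ M.toFinset, (M.erase b).card = n := fun b hb => by
      rw [Multiset.card_erase_of_mem (Multiset.mem_toFinset.mp hb), hn]; rfl
    have euler := congrArg borelEval (sum_contentPoly_erase hS l)
    rw [map_sum, map_sub, ← C_eq_natCast, borelEval_C_mul, hn] at euler
    rw [Nat.factorial_succ, Nat.cast_mul, mul_comm ((n + 1 : ℕ) : ℂ), mul_assoc]
    cases l with
    | nil =>
      rw [derivative_contentPoly_nil, mul_zero, map_zero, sub_zero] at euler
      rw [wordCount_nil hM, ← euler, Finset.mul_sum, Nat.cast_sum]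
      exact Finset.sum_congr rfl fun b hb => ih (hsub b) hl hlS (hcard b hb)
    | cons a l =>
      rw [List.nodup_cons] at hl
      have hlS' : ∀ i ∈ l, i ∈ S := fun i hi => hlS i (List.mem_cons_of_mem _ hi)
      rw [borelEval_euler_contentPoly (hlS a (by simp)) hl.1] at euler
      rw [eq_sub_iff_add_eq] at euler
      rw [wordCount_cons hM, ← euler, mul_add, Finset.mul_sum, Nat.cast_sum]
      have h1 : ∀ b ∈ M.toFinset,
          (((if b = a then wordCount (M.erase b) l else wordCount (M.erase b) (a :: l) : ℕ)) : ℂ)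
          = (n.factorial : ℂ) * borelEval (contentPoly S (M.erase b) (a :: l))
            + if a = b then (n.factorial : ℂ) * (borelEval (contentPoly S (M.erase a) l)
              - borelEval (contentPoly S (M.erase a) (a :: l))) else 0 := by
        intro b hb
        by_cases hba : b = a
        · subst hba
          rw [if_pos rfl, if_pos rfl, ih (hsub b) hl.2 hlS' (hcard b hb)]; ring
        · rw [if_neg hba, if_neg (Ne.symm hba), add_zero]
          exact ih (hsub b) (List.nodup_cons.mpr hl) hlS (hcard b hb)
      rw [Finset.sum_congr rfl h1, Finset.sum_add_distrib, Finset.sum_ite_eq]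
      simp only [Multiset.mem_toFinset]
      congr 1
      split_ifs <;> simp

/-! ### The expectation as a sum of Borel values of powers -/

theorem findGreatest_eq_sum (P : ℕ → Prop) [DecidablePred P] (hP : ∀ k, P (k + 1) → P k)
    (N : ℕ) : Nat.findGreatest P N = ∑ k ∈ Finset.range N, if P (k + 1) then 1 else 0 := by
  induction N with
  | zero => simp
  | succ N ih =>
    rw [Nat.findGreatest_succ, Finset.sum_range_succ, ← ih]
    split_ifs with h
    · have : Nat.findGreatest P N = N := by
        cases N with
        | zero => simp
        | succ N => exact Nat.findGreatest_eq (hP _ h)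
      rw [this]
    · rfl

theorem contIncLength_eq_sum {m n : ℕ} (hm : 1 ≤ m) {w : List ℕ} (hw : w ∈ multisetPerms m n) :
    contIncLength 1 w
      = ∑ k ∈ Finset.range n, if (List.range' 1 (k + 1)).Sublist w then 1 else 0 := by
  have hlen : n ≤ w.length := by
    have hw' : (w : Multiset ℕ) = m • (Finset.Icc 1 n).val :=
      mem_lists_iff_coe_eq.mp (Multiset.mem_toFinset.mp hw)
    have := congrArg Multiset.card hw'
    simp only [Multiset.coe_card, Multiset.card_nsmul, Finset.card_val, Nat.card_Icc,
      Nat.add_sub_cancel] at this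
    rw [this]
    exact Nat.le_mul_of_pos_left n hm
  rw [contIncLength, findGreatest_eq_sum]
  · refine (Finset.sum_subset (Finset.range_mono hlen) fun k _ hk => if_neg fun h => ?_).symm
    have h1 : k + 1 ∈ w := h.subset (by simp [List.mem_range'_1])
    have h2 := mem_multisetPerms.mp hw (k + 1)
    rw [if_neg (by simp at hk ⊢; omega), List.count_eq_zero] at h2
    exact h2 h1
  · intro k h
    refine List.Sublist.trans ?_ h
    rw [List.range'_concat]
    exact List.sublist_append_left _ _

theorem contentPoly_range' {m n k : ℕ} (hk : k ≤ n) :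
    contentPoly (Finset.Icc 1 n) (m • (Finset.Icc 1 n).val) (List.range' 1 k)
      = C (((m.factorial : ℂ)⁻¹) ^ n) * (C (m.factorial : ℂ) * markedFactor m) ^ k := by
  have h0 : C ((m.factorial : ℂ)⁻¹) * C (m.factorial : ℂ) = 1 := by
    rw [← C_mul, inv_mul_cancel₀ (by exact_mod_cast m.factorial_ne_zero), C_1]
  have h1 : ∀ i ∈ Finset.Icc 1 n,
      letterFactor (i ∈ List.range' 1 k) ((m • (Finset.Icc 1 n).val).count i)
      = C ((m.factorial : ℂ)⁻¹)
        * if i ∈ Finset.Icc 1 k then C (m.factorial : ℂ) * markedFactor m else 1 := by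
    intro i hi
    rw [Multiset.count_nsmul, Multiset.count_eq_one_of_mem (Finset.Icc 1 n).nodup hi, mul_one,
      letterFactor]
    have : i ∈ List.range' 1 k ↔ i ∈ Finset.Icc 1 k := by
      rw [List.mem_range'_1, Finset.mem_Icc]; omega
    simp only [this]
    split_ifs
    · rw [← mul_assoc, h0, one_mul]
    · rw [mul_one]
  rw [contentPoly, Finset.prod_congr rfl h1, Finset.prod_mul_distrib, Finset.prod_const,
    Nat.card_Icc, Nat.add_sub_cancel, C_pow]
  congr 1
  rw [Finset.prod_ite_mem, Finset.prod_const,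
    Finset.inter_eq_right.mpr (Finset.Icc_subset_Icc_right hk), Nat.card_Icc, Nat.add_sub_cancel]

/-- The probability that `1 2 ⋯ k` is a subsequence of a random word does not depend on `n ≥ k`;
it is the Borel value of the `k`-th power of `m! * markedFactor m`. -/
theorem expectedL1_eq_sum {m : ℕ} (hm : 1 ≤ m) (n : ℕ) :
    (expectedL1 m n : ℂ)
      = ∑ k ∈ Finset.range n, borelEval ((C (m.factorial : ℂ) * markedFactor m) ^ (k + 1)) := by
  set M : Multiset ℕ := m • (Finset.Icc 1 n).val with hMdef
  have hS : M.toFinset ⊆ Finset.Icc 1 n := fun x hx =>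
    Multiset.mem_of_mem_nsmul (Multiset.mem_toFinset.mp hx)
  have hcount : ∀ k ≤ n, (wordCount M (List.range' 1 k) : ℂ)
      = (M.card.factorial : ℂ) * (((m.factorial : ℂ)⁻¹) ^ n
        * borelEval ((C (m.factorial : ℂ) * markedFactor m) ^ k)) := by
    intro k hk
    rw [wordCount_eq hS List.nodup_range', contentPoly_range' hk, borelEval_C_mul]
    intro i hi
    rw [List.mem_range'_1] at hi
    rw [Finset.mem_Icc]; omega
  have hne : (M.card.factorial : ℂ) * ((m.factorial : ℂ)⁻¹) ^ n ≠ 0 :=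
    mul_ne_zero (by exact_mod_cast Nat.factorial_ne_zero _)
      (pow_ne_zero _ (inv_ne_zero (by exact_mod_cast m.factorial_ne_zero)))
  have htot : ((multisetPerms m n).card : ℂ)
      = (M.card.factorial : ℂ) * ((m.factorial : ℂ)⁻¹) ^ n := by
    have h1 : borelEval 1 = 1 := by
      rw [← monomial_zero_one, borelEval_monomial]; simp
    have h := hcount 0 (Nat.zero_le n)
    rw [pow_zero, h1, mul_one] at h
    rw [← h, wordCount, multisetPerms]
    simp [hMdef]
  have hsum : ∑ w ∈ multisetPerms m n, contIncLength 1 w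
      = ∑ k ∈ Finset.range n, wordCount M (List.range' 1 (k + 1)) := by
    rw [Finset.sum_congr rfl fun w hw => contIncLength_eq_sum hm hw, Finset.sum_comm]
    refine Finset.sum_congr rfl fun k _ => ?_
    rw [← Finset.card_filter]; rfl
  have hE : (expectedL1 m n : ℂ)
      = ((∑ w ∈ multisetPerms m n, contIncLength 1 w : ℕ) : ℂ) / (multisetPerms m n).card := by
    rw [expectedL1, Finset.expect_eq_sum_div_card]
    push_cast
    rfl
  rw [hE, hsum, htot, div_eq_iff hne, Nat.cast_sum, Finset.sum_mul]
  refine Finset.sum_congr rfl fun k hk => ?_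
  rw [hcount (k + 1) (Finset.mem_range.mp hk)]
  ring

/-! ### Zeros of the truncated exponential and their negative power sums -/

theorem truncExp_coeff (m k : ℕ) :
    (truncExp m).coeff k = if k ≤ m then (k.factorial : ℂ)⁻¹ else 0 := by
  rw [truncExp, finsetSum_coeff]
  simp only [coeff_monomial, Finset.sum_ite_eq', Finset.mem_range, Nat.lt_succ_iff]

theorem truncExp_eval (m : ℕ) (x : ℂ) :
    (truncExp m).eval x = ∑ k ∈ Finset.range (m + 1), x ^ k / (k.factorial : ℂ) := by
  rw [truncExp, eval_finsetSum]
  exact Finset.sum_congr rfl fun k _ => by rw [eval_monomial, mul_comm, div_eq_mul_inv]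

theorem truncExp_natDegree (m : ℕ) : (truncExp m).natDegree = m := by
  refine natDegree_eq_of_le_of_coeff_ne_zero ?_ ?_
  · rw [natDegree_le_iff_coeff_eq_zero]
    intro k hk
    rw [truncExp_coeff, if_neg (not_le.mpr hk)]
  · rw [truncExp_coeff, if_pos le_rfl]
    exact inv_ne_zero (by exact_mod_cast m.factorial_ne_zero)

theorem truncExp_ne_zero (m : ℕ) : truncExp m ≠ 0 := by
  intro h
  have := truncExp_coeff m 0
  simp [h] at this

theorem truncExp_derivative (m : ℕ) : derivative (truncExp (m + 1)) = truncExp m := by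
  ext k
  rw [coeff_derivative, truncExp_coeff, truncExp_coeff]
  simp only [Nat.add_le_add_iff_right]
  split_ifs
  · rw [Nat.factorial_succ]
    have h2 : ((k : ℂ) + 1) ≠ 0 := by exact_mod_cast k.succ_ne_zero
    push_cast
    field_simp
  · simp

theorem truncExp_succ_eval (m : ℕ) (x : ℂ) :
    (truncExp (m + 1)).eval x = (truncExp m).eval x + x ^ (m + 1) / ((m + 1).factorial : ℂ) := by
  rw [truncExp_eval, truncExp_eval, Finset.sum_range_succ]

/-- The zeros of `E_m`; they are all simple (`nodup_roots_truncExp`). -/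
noncomputable def expZeros (m : ℕ) : Finset ℂ := (truncExp m).roots.toFinset

theorem eval_of_mem_expZeros {m : ℕ} {α : ℂ} (h : α ∈ expZeros m) : (truncExp m).eval α = 0 := by
  rw [expZeros, Multiset.mem_toFinset] at h
  exact (mem_roots'.mp h).2

theorem ne_zero_of_mem_expZeros {m : ℕ} {α : ℂ} (h : α ∈ expZeros m) : α ≠ 0 := by
  rintro rfl
  have h1 := eval_of_mem_expZeros h
  rw [← coeff_zero_eq_eval_zero, truncExp_coeff] at h1
  simp at h1

theorem truncExp_pred_eval {m : ℕ} {α : ℂ} (h : α ∈ expZeros (m + 1)) :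
    (truncExp m).eval α = -(α ^ (m + 1) / ((m + 1).factorial : ℂ)) := by
  have := eval_of_mem_expZeros h
  rw [truncExp_succ_eval] at this
  exact eq_neg_of_add_eq_zero_left this

theorem nodup_roots_truncExp (m : ℕ) : (truncExp m).roots.Nodup := by
  rw [Multiset.nodup_iff_count_le_one]
  intro α
  rw [count_roots]
  by_contra! h
  have hr := (one_lt_rootMultiplicity_iff_isRoot (truncExp_ne_zero m)).mp h
  have hα : α ∈ expZeros m := by
    rw [expZeros, Multiset.mem_toFinset, mem_roots (truncExp_ne_zero m)]
    exact hr.1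
  cases m with
  | zero =>
    have := eval_of_mem_expZeros hα
    simp [truncExp_eval] at this
  | succ m =>
    have h2 := hr.2
    rw [truncExp_derivative, IsRoot.def, truncExp_pred_eval hα, neg_eq_zero] at h2
    exact div_ne_zero (pow_ne_zero _ (ne_zero_of_mem_expZeros hα))
      (by exact_mod_cast Nat.factorial_ne_zero _) h2

theorem sum_roots_truncExp (m : ℕ) (f : ℂ → ℂ) :
    ((truncExp m).roots.map f).sum = ∑ α ∈ expZeros m, f α := by
  rw [Finset.sum, expZeros, Multiset.toFinset_val, (nodup_roots_truncExp m).dedup]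

theorem card_expZeros (m : ℕ) : (expZeros m).card = m := by
  rw [expZeros, Multiset.toFinset_card_of_nodup (nodup_roots_truncExp m),
    ← (IsAlgClosed.splits (truncExp m)).natDegree_eq_card_roots, truncExp_natDegree]

theorem truncExp_eq_nodal (m : ℕ) :
    truncExp m = C ((m.factorial : ℂ)⁻¹) * Lagrange.nodal (expZeros m) id := by
  have h := (IsAlgClosed.splits (truncExp m)).eq_prod_roots
  have hl : (truncExp m).leadingCoeff = (m.factorial : ℂ)⁻¹ := by
    rw [leadingCoeff, truncExp_natDegree, truncExp_coeff, if_pos le_rfl]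
  rw [hl] at h
  conv_lhs => rw [h]
  rw [Lagrange.nodal, Finset.prod, expZeros, Multiset.toFinset_val, (nodup_roots_truncExp m).dedup]
  rfl

/-- `E_m'(α) = E_{m-1}(α) = -α ^ m / m!` at a zero `α`, in terms of the other zeros. -/
theorem prod_erase_expZeros {m : ℕ} (hm : 1 ≤ m) {α : ℂ} (h : α ∈ expZeros m) :
    ∏ β ∈ (expZeros m).erase α, (α - β) = -α ^ m := by
  obtain ⟨m, rfl⟩ := Nat.exists_eq_add_of_le' hm
  have hd := truncExp_derivative m
  rw [truncExp_eq_nodal (m + 1), derivative_C_mul] at hd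
  have he := congrArg (eval α) hd
  rw [truncExp_pred_eval h, eval_mul, eval_C] at he
  have h2 := Lagrange.eval_nodal_derivative_eval_node_eq (v := (id : ℂ → ℂ)) h
  rw [id, Lagrange.eval_nodal] at h2
  rw [h2] at he
  have h1 : ((m + 1).factorial : ℂ) ≠ 0 := by exact_mod_cast Nat.factorial_ne_zero _
  simp only [id] at he
  field_simp at he
  exact he

/-- The power sum `∑ α ^ r` over the zeros of `E_m`, for an integer `r`. -/
noncomputable def zeroPowerSum (m : ℕ) (r : ℤ) : ℂ := ∑ α ∈ expZeros m, α ^ r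

theorem zeroPowerSum_rec (m : ℕ) (r : ℤ) :
    ∑ k ∈ Finset.range (m + 1), zeroPowerSum m (r + k) / (k.factorial : ℂ) = 0 := by
  simp only [zeroPowerSum, Finset.sum_div]
  rw [Finset.sum_comm]
  refine Finset.sum_eq_zero fun α hα => ?_
  have h := eval_of_mem_expZeros hα
  rw [truncExp_eval] at h
  have h0 := ne_zero_of_mem_expZeros hα
  rw [← mul_zero (α ^ r), ← h, Finset.mul_sum]
  refine Finset.sum_congr rfl fun k _ => ?_
  rw [zpow_add₀ h0, zpow_natCast, mul_div_assoc]

/-- Lagrange interpolation at the zeros of `E_m`, applied to the powers `X ^ j` with `j < m`. -/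
theorem zeroPowerSum_neg {m : ℕ} (hm : 1 ≤ m) {j : ℕ} (hj : j < m) :
    zeroPowerSum m ((j : ℤ) - m) = if j = m - 1 then -1 else 0 := by
  have h := Lagrange.coeff_eq_sum (s := expZeros m) (v := id) (Function.injective_id.injOn)
    (P := (X : ℂ[X]) ^ j) (by rw [card_expZeros, degree_X_pow]; exact_mod_cast hj)
  rw [card_expZeros, coeff_X_pow] at h
  have h2 : ∑ i ∈ expZeros m, eval (id i) ((X : ℂ[X]) ^ j)
      / ∏ β ∈ (expZeros m).erase i, (id i - id β) = - zeroPowerSum m ((j : ℤ) - m) := by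
    rw [zeroPowerSum, ← Finset.sum_neg_distrib]
    refine Finset.sum_congr rfl fun α hα => ?_
    simp only [id, eval_pow, eval_X]
    rw [prod_erase_expZeros hm hα, zpow_sub₀ (ne_zero_of_mem_expZeros hα), zpow_natCast,
      zpow_natCast, div_neg]
  rw [h2] at h
  rw [← neg_eq_iff_eq_neg.mpr h]
  simp only [eq_comm (a := m - 1)]
  split_ifs <;> simp

theorem zeroPowerSum_neg_one {m : ℕ} (hm : 1 ≤ m) : zeroPowerSum m (-1) = -1 := by
  have h := zeroPowerSum_neg hm (j := m - 1) (by omega)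
  rw [if_pos rfl] at h
  rw [← h]; congr 1; omega

theorem zeroPowerSum_eq_zero {m : ℕ} {r : ℤ} (h1 : -(m : ℤ) ≤ r) (h2 : r ≤ -2) :
    zeroPowerSum m r = 0 := by
  have h := zeroPowerSum_neg (m := m) (by omega) (j := (r + m).toNat) (by omega)
  rw [if_neg (by omega)] at h
  rw [← h]; congr 1; omega

theorem zeroPowerSum_neg_succ {m : ℕ} (hm : 1 ≤ m) :
    zeroPowerSum m (-(m + 1)) = 1 / (m.factorial : ℂ) := by
  have h := zeroPowerSum_rec m (-(m + 1))
  obtain ⟨m, rfl⟩ := Nat.exists_eq_add_of_le' hm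
  rw [Finset.sum_range_succ, Finset.sum_range_succ', Finset.sum_eq_zero] at h
  · have e : (-(((m + 1 : ℕ) : ℤ) + 1) + ((m + 1 : ℕ) : ℤ)) = -1 := by ring
    rw [e, zeroPowerSum_neg_one hm] at h
    simp only [Nat.cast_zero, add_zero, Nat.factorial_zero, Nat.cast_one, div_one, zero_add] at h
    linear_combination h
  · intro k hk
    rw [Finset.mem_range] at hk
    rw [zeroPowerSum_eq_zero (by omega) (by omega), zero_div]

theorem zeroPowerSum_neg_succ_succ {m : ℕ} (hm : 1 ≤ m) :
    zeroPowerSum m (-(m + 2)) = -(1 / (m.factorial : ℂ)) := by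
  have h := zeroPowerSum_rec m (-(m + 2))
  obtain ⟨m, rfl⟩ := Nat.exists_eq_add_of_le' hm
  rw [Finset.sum_range_succ', Finset.sum_range_succ', Finset.sum_eq_zero] at h
  · have e : (-(((m + 1 : ℕ) : ℤ) + 2) + ((0 + 1 : ℕ) : ℤ)) = -(((m + 1 : ℕ) : ℤ) + 1) := by
      push_cast; ring
    rw [e, zeroPowerSum_neg_succ hm] at h
    simp only [Nat.cast_zero, add_zero, Nat.factorial_zero, Nat.cast_one, div_one, zero_add,
      Nat.factorial_one] at h
    linear_combination h
  · intro k hk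
    rw [Finset.mem_range] at hk
    rw [zeroPowerSum_eq_zero (by omega) (by omega), zero_div]

/-! ### The sum of the Borel values of the powers -/

theorem hasSum_borelEval (p : ℂ[X]) :
    HasSum (fun j => p.coeff j / (j.factorial : ℂ)) (borelEval p) := by
  rw [borelEval_apply, Polynomial.sum]
  have h : ∑ j ∈ p.support, (j.factorial : ℂ)⁻¹ * p.coeff j
      = ∑ j ∈ p.support, p.coeff j / (j.factorial : ℂ) :=
    Finset.sum_congr rfl fun j _ => by rw [mul_comm, div_eq_mul_inv]
  rw [h]
  refine hasSum_sum_of_ne_finset_zero fun j hj => ?_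
  rw [notMem_support_iff.mp hj, zero_div]

/-- If the coefficients of `g` are small at scale `ρ`, multiplication by `g` halves the weighted
sup norm `sup_j ‖f_j‖ / ρ ^ j`. -/
theorem norm_coeff_pow_mul_le {g f : PowerSeries ℂ} {ρ B : ℝ}
    (hg : ∀ n, ∑ i ∈ Finset.range (n + 1), ‖PowerSeries.coeff i g‖ * ρ ^ (n - i) ≤ ρ ^ n / 2)
    (hB : 0 ≤ B) (hf : ∀ j, ‖PowerSeries.coeff j f‖ ≤ B * ρ ^ j) (K j : ℕ) :
    ‖PowerSeries.coeff j (g ^ K * f)‖ ≤ B * (1 / 2) ^ K * ρ ^ j := by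
  induction K generalizing j with
  | zero => simpa using hf j
  | succ K ih =>
    rw [pow_succ', mul_assoc, PowerSeries.coeff_mul,
      Finset.Nat.sum_antidiagonal_eq_sum_range_succ_mk]
    refine (norm_sum_le _ _).trans ?_
    calc ∑ i ∈ Finset.range (j + 1),
          ‖PowerSeries.coeff i g * PowerSeries.coeff (j - i) (g ^ K * f)‖
        ≤ ∑ i ∈ Finset.range (j + 1),
          B * (1 / 2) ^ K * (‖PowerSeries.coeff i g‖ * ρ ^ (j - i)) := by
          refine Finset.sum_le_sum fun i _ => ?_
          rw [norm_mul]
          calc _ ≤ ‖PowerSeries.coeff i g‖ * (B * (1 / 2) ^ K * ρ ^ (j - i)) := by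
                gcongr; exact ih _
            _ = _ := by ring
      _ ≤ B * (1 / 2) ^ K * (ρ ^ j / 2) := by
          rw [← Finset.mul_sum]
          exact mul_le_mul_of_nonneg_left (hg j) (by positivity)
      _ = _ := by rw [pow_succ]; ring

/-- A polynomial without constant term is small at every large enough scale. -/
theorem sum_norm_coeff_mul_pow_le {p : ℂ[X]} (h0 : p.coeff 0 = 0) {ρ : ℝ} (h1 : 1 ≤ ρ)
    (hρ : 2 * ∑ i ∈ p.support, ‖p.coeff i‖ ≤ ρ) (n : ℕ) :
    ∑ i ∈ Finset.range (n + 1), ‖PowerSeries.coeff i (p : PowerSeries ℂ)‖ * ρ ^ (n - i)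
      ≤ ρ ^ n / 2 := by
  simp only [Polynomial.coeff_coe]
  rw [Finset.sum_range_succ', h0, norm_zero, zero_mul, add_zero]
  cases n with
  | zero => simp
  | succ n =>
    have hsum : ∑ i ∈ Finset.range (n + 1), ‖p.coeff (i + 1)‖ ≤ ∑ i ∈ p.support, ‖p.coeff i‖ := by
      have e : ∑ i ∈ Finset.range (n + 1), ‖p.coeff (i + 1)‖
          = ∑ i ∈ Finset.range (n + 2), ‖p.coeff i‖ := by
        rw [Finset.sum_range_succ' _ (n + 1), h0, norm_zero, add_zero]
      rw [e, ← Finset.sum_filter_add_sum_filter_not _ (fun i => i ∈ p.support)]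
      have z : ∑ i ∈ (Finset.range (n + 2)).filter (fun i => ¬ i ∈ p.support), ‖p.coeff i‖ = 0 := by
        refine Finset.sum_eq_zero fun i hi => ?_
        rw [notMem_support_iff.mp (Finset.mem_filter.mp hi).2, norm_zero]
      rw [z, add_zero]
      exact Finset.sum_le_sum_of_subset_of_nonneg (fun i hi => (Finset.mem_filter.mp hi).2)
        fun _ _ _ => norm_nonneg _
    calc ∑ i ∈ Finset.range (n + 1), ‖p.coeff (i + 1)‖ * ρ ^ (n + 1 - (i + 1))
        ≤ ∑ i ∈ Finset.range (n + 1), ‖p.coeff (i + 1)‖ * ρ ^ n := by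
          refine Finset.sum_le_sum fun i _ => ?_
          gcongr
          omega
      _ ≤ ρ / 2 * ρ ^ n := by
          rw [← Finset.sum_mul]
          gcongr
          linarith
      _ = _ := by rw [pow_succ]; ring

theorem markedFactor_coeff_zero (c : ℕ) : (markedFactor c).coeff 0 = 0 := by
  cases c <;> simp [markedFactor]

theorem markedFactor_coeff_succ (c j : ℕ) :
    (markedFactor c).coeff (j + 1)
      = if j + 1 ≤ c then (-1) ^ j / ((c - (j + 1)).factorial : ℂ) else 0 := by
  induction c generalizing j with
  | zero => simp [markedFactor]
  | succ c ih =>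
    rw [markedFactor, coeff_X_mul, coeff_sub, coeff_C]
    cases j with
    | zero => simp [markedFactor_coeff_zero]
    | succ j =>
      rw [if_neg (by simp), ih, zero_sub]
      simp only [Nat.add_le_add_iff_right, Nat.add_sub_add_right]
      split_ifs
      · rw [pow_succ]; ring
      · simp

/-- The power series `-∑ α⁻¹ / (1 + α X)` over the zeros `α` of `E_m`. -/
noncomputable def zeroSeries (m : ℕ) : PowerSeries ℂ :=
  PowerSeries.mk fun j => -∑ α ∈ expZeros m, α⁻¹ * (-α) ^ j

theorem coeff_zeroSeries (m j : ℕ) :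
    PowerSeries.coeff j (zeroSeries m) = (-1) ^ (j + 1) * zeroPowerSum m ((j : ℤ) - 1) := by
  rw [zeroSeries, PowerSeries.coeff_mk, zeroPowerSum, pow_succ, mul_neg_one, neg_mul, Finset.mul_sum]
  congr 1
  refine Finset.sum_congr rfl fun α hα => ?_
  rw [zpow_sub₀ (ne_zero_of_mem_expZeros hα), zpow_natCast, zpow_one, neg_pow, div_eq_mul_inv]
  ring

/-- Partial fractions: `1 - m! * markedFactor m = X ^ m m! (-1) ^ m E_m(-1 / X)` is the reversed
polynomial of `E_m(-X)` up to a factor, and `zeroSeries m` is its inverse. -/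
theorem one_sub_mul_zeroSeries {m : ℕ} (hm : 1 ≤ m) :
    (1 - ((C (m.factorial : ℂ) * markedFactor m : ℂ[X]) : PowerSeries ℂ)) * zeroSeries m = 1 := by
  have hmf : (m.factorial : ℂ) ≠ 0 := by exact_mod_cast m.factorial_ne_zero
  have hcoeff : ∀ i, PowerSeries.coeff i
      (1 - ((C (m.factorial : ℂ) * markedFactor m : ℂ[X]) : PowerSeries ℂ))
      = if i ≤ m then (-1) ^ i * (m.factorial : ℂ) / ((m - i).factorial : ℂ) else 0 := by
    intro i
    rw [map_sub, Polynomial.coeff_coe, coeff_C_mul, PowerSeries.coeff_one]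
    cases i with
    | zero => simp [markedFactor_coeff_zero, hmf]
    | succ i =>
      rw [if_neg (by simp), markedFactor_coeff_succ]
      split_ifs
      · rw [pow_succ]; ring
      · simp
  ext n
  rw [PowerSeries.coeff_mul, Finset.Nat.sum_antidiagonal_eq_sum_range_succ_mk,
    PowerSeries.coeff_one]
  simp only [hcoeff, coeff_zeroSeries]
  cases n with
  | zero =>
    simp only [zero_add, Finset.sum_range_one, Nat.zero_le, if_true, Nat.sub_zero, Nat.cast_zero,
      zero_sub, zeroPowerSum_neg_one hm]
    field_simp
  | succ n =>
    rw [if_neg (by simp)]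
    -- The terms with `n + 1 < i ≤ m` that are missing from the full recursion vanish.
    set F : ℕ → ℂ := fun i =>
      if i ≤ m then zeroPowerSum m ((n : ℤ) - i) / ((m - i).factorial : ℂ) else 0 with hF
    have h1 : ∀ i ∈ Finset.range (n + 1 + 1),
        (if i ≤ m then (-1) ^ i * (m.factorial : ℂ) / ((m - i).factorial : ℂ) else 0)
          * ((-1) ^ (n + 1 - i + 1) * zeroPowerSum m (((n + 1 - i : ℕ) : ℤ) - 1))
        = (-1) ^ n * (m.factorial : ℂ) * F i := by
      intro i hi
      have hi' : i ≤ n + 1 := by rw [Finset.mem_range] at hi; omega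
      simp only [hF]
      split_ifs
      · have e : (((n + 1 - i : ℕ) : ℤ) - 1) = (n : ℤ) - i := by omega
        have e2 : (-1 : ℂ) ^ i * (-1) ^ (n + 1 - i + 1) = (-1) ^ n := by
          rw [← pow_add, show i + (n + 1 - i + 1) = n + 2 by omega, pow_add]; norm_num
        rw [e, ← e2]; ring
      · simp
    rw [Finset.sum_congr rfl h1, ← Finset.mul_sum]
    have hz : ∀ i, n + 2 ≤ i → F i = 0 := by
      intro i hi
      simp only [hF]
      split_ifs
      · rw [zeroPowerSum_eq_zero (by omega) (by omega), zero_div]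
      · rfl
    have s1 : ∑ i ∈ Finset.range (n + 1 + 1), F i = ∑ i ∈ Finset.range (n + m + 2), F i := by
      refine Finset.sum_subset (Finset.range_mono (by omega)) fun i _ hi => hz i ?_
      rw [Finset.mem_range] at hi; omega
    have s2 : ∑ i ∈ Finset.range (m + 1), F i = ∑ i ∈ Finset.range (n + m + 2), F i := by
      refine Finset.sum_subset (Finset.range_mono (by omega)) fun i _ hi => ?_
      rw [Finset.mem_range] at hi
      exact if_neg (by omega)
    have s3 : ∑ i ∈ Finset.range (m + 1), F i = 0 := by
      rw [← zeroPowerSum_rec m ((n : ℤ) - m), ← Finset.sum_range_reflect]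
      refine Finset.sum_congr rfl fun k hk => ?_
      rw [Finset.mem_range] at hk
      simp only [hF]
      rw [if_pos (by omega)]
      congr 2
      · omega
      · congr 1; omega
    rw [s1, ← s2, s3, mul_zero]

/-- The value at `1` of the renewal function, `-∑ α⁻¹ e^{-α}` over the zeros `α` of `E_m`. -/
noncomputable def renewalValue (m : ℕ) : ℂ := -∑ α ∈ expZeros m, α⁻¹ * Complex.exp (-α)

theorem hasSum_zeroSeries (m : ℕ) :
    HasSum (fun j => PowerSeries.coeff j (zeroSeries m) / (j.factorial : ℂ)) (renewalValue m) := by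
  have h : ∀ α ∈ expZeros m, HasSum (fun j : ℕ => α⁻¹ * ((-α) ^ j / (j.factorial : ℂ)))
      (α⁻¹ * Complex.exp (-α)) := fun α _ => by
    rw [Complex.exp_eq_exp_ℂ]
    exact (NormedSpace.expSeries_div_hasSum_exp (-α)).mul_left _
  have h2 := (hasSum_sum h).neg
  rw [← renewalValue] at h2
  refine h2.congr_fun fun j => ?_
  rw [zeroSeries, PowerSeries.coeff_mk, neg_div, Finset.sum_div]
  simp only [mul_div_assoc]

theorem tendsto_sum_borelEval {m : ℕ} (hm : 1 ≤ m) :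
    Filter.Tendsto
      (fun K => ∑ k ∈ Finset.range K, borelEval ((C (m.factorial : ℂ) * markedFactor m) ^ k))
      Filter.atTop (nhds (renewalValue m)) := by
  set p : ℂ[X] := C (m.factorial : ℂ) * markedFactor m with hp
  set ρ : ℝ := 1 + 2 * ∑ i ∈ p.support, ‖p.coeff i‖ + ∑ α ∈ expZeros m, ‖α‖ with hρ
  set B : ℝ := ∑ α ∈ expZeros m, ‖α⁻¹‖ with hB
  have hp1 : 0 ≤ ∑ i ∈ p.support, ‖p.coeff i‖ := Finset.sum_nonneg fun _ _ => norm_nonneg _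
  have hp2 : 0 ≤ ∑ α ∈ expZeros m, ‖α‖ := Finset.sum_nonneg fun _ _ => norm_nonneg _
  have hB0 : 0 ≤ B := Finset.sum_nonneg fun _ _ => norm_nonneg _
  have hp0 : p.coeff 0 = 0 := by rw [hp, coeff_C_mul, markedFactor_coeff_zero, mul_zero]
  have hf : ∀ j, ‖PowerSeries.coeff j (zeroSeries m)‖ ≤ B * ρ ^ j := by
    intro j
    rw [zeroSeries, PowerSeries.coeff_mk, norm_neg, hB, Finset.sum_mul]
    refine (norm_sum_le _ _).trans (Finset.sum_le_sum fun α hα => ?_)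
    rw [norm_mul, norm_pow, norm_neg]
    gcongr
    have := Finset.single_le_sum (f := fun α : ℂ => ‖α‖) (fun _ _ => norm_nonneg _) hα
    linarith
  have hbound := norm_coeff_pow_mul_le
    (sum_norm_coeff_mul_pow_le hp0 (ρ := ρ) (by linarith) (by linarith)) hB0 hf
  have hgeom : ∀ K, (p : PowerSeries ℂ) ^ K * zeroSeries m
      = zeroSeries m - ((∑ k ∈ Finset.range K, p ^ k : ℂ[X]) : PowerSeries ℂ) := by
    intro K
    have h1 := one_sub_mul_zeroSeries hm
    rw [← hp] at h1
    have h2 := mul_neg_geom_sum (p : PowerSeries ℂ) K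
    have h3 : ((∑ k ∈ Finset.range K, p ^ k : ℂ[X]) : PowerSeries ℂ)
        = ∑ k ∈ Finset.range K, (p : PowerSeries ℂ) ^ k := by
      rw [← Polynomial.coeToPowerSeries.ringHom_apply, map_sum]
      simp
    rw [h3]
    linear_combination zeroSeries m * h2 - (∑ k ∈ Finset.range K, (p : PowerSeries ℂ) ^ k) * h1
  have hnorm : ∀ K, ‖renewalValue m - ∑ k ∈ Finset.range K, borelEval (p ^ k)‖
      ≤ B * Real.exp ρ * (1 / 2) ^ K := by
    intro K
    have hs := (hasSum_zeroSeries m).sub (hasSum_borelEval (∑ k ∈ Finset.range K, p ^ k))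
    rw [map_sum] at hs
    rw [← hs.tsum_eq]
    have he : HasSum (fun j : ℕ => B * (1 / 2) ^ K * (ρ ^ j / (j.factorial : ℝ)))
        (B * (1 / 2) ^ K * Real.exp ρ) := by
      rw [Real.exp_eq_exp_ℝ]
      exact (NormedSpace.expSeries_div_hasSum_exp ρ).mul_left _
    refine (tsum_of_norm_bounded he fun j => ?_).trans (le_of_eq (by ring))
    rw [← sub_div, ← Polynomial.coeff_coe, ← map_sub, ← hgeom, norm_div, Complex.norm_natCast,
      ← mul_div_assoc]
    exact div_le_div_of_nonneg_right (hbound K j) (Nat.cast_nonneg _)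
  rw [tendsto_iff_norm_sub_tendsto_zero]
  simp only [norm_sub_rev _ (renewalValue m)]
  refine squeeze_zero (fun _ => norm_nonneg _) hnorm ?_
  have := (tendsto_pow_atTop_nhds_zero_of_lt_one (r := (1 / 2 : ℝ)) (by norm_num)
    (by norm_num)).const_mul (B * Real.exp ρ)
  rwa [mul_zero] at this

/-- The limit of the expectations; the term `1` is the empty subsequence. -/
theorem tendsto_expectedL1 {m : ℕ} (hm : 1 ≤ m) :
    Filter.Tendsto (fun n => (expectedL1 m n : ℂ)) Filter.atTop (nhds (renewalValue m - 1)) := by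
  have h := ((tendsto_sum_borelEval hm).comp (Filter.tendsto_add_atTop_nat 1)).sub_const 1
  refine h.congr fun n => ?_
  have h1 : borelEval 1 = 1 := by
    rw [← monomial_zero_one, borelEval_monomial]; simp
  rw [expectedL1_eq_sum hm, Function.comp_apply, Finset.sum_range_succ', pow_zero, h1]
  ring

/-! ### The renewal density and its convolution equation -/

theorem truncExp_sub_derivative (c : ℕ) :
    truncExp c - derivative (truncExp c) = monomial c ((c.factorial : ℂ)⁻¹) := by
  cases c with
  | zero => simp [truncExp]
  | succ c =>
    rw [truncExp_derivative, truncExp, Finset.sum_range_succ, ← truncExp]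
    ring

/-- Convolution of a power of `1 - x` with an exponential. The function
`x ↦ e^{-α(t-x)} E_c(α(1-x))` is an antiderivative up to a factor, because
`E_c - E_c' = X ^ c / c!`. -/
theorem integral_one_sub_pow_mul_exp (c : ℕ) {α : ℂ} (hα : α ≠ 0) (t : ℝ) :
    ∫ x in (0 : ℝ)..t, (1 - (x : ℂ)) ^ c * Complex.exp (-α * ((t - x : ℝ) : ℂ))
      = (c.factorial : ℂ) * (α ^ (c + 1))⁻¹
        * ((truncExp c).eval (α * (1 - t)) - (truncExp c).eval α * Complex.exp (-α * t)) := by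
  have hc : (c.factorial : ℂ) ≠ 0 := by exact_mod_cast c.factorial_ne_zero
  set F : ℝ → ℂ := fun x =>
    Complex.exp (-α * ((t - x : ℝ) : ℂ)) * (truncExp c).eval (α * (1 - (x : ℂ))) with hF
  have hder : ∀ x : ℝ, HasDerivAt F
      (α ^ (c + 1) * (c.factorial : ℂ)⁻¹
        * ((1 - (x : ℂ)) ^ c * Complex.exp (-α * ((t - x : ℝ) : ℂ)))) x := by
    intro x
    have hx : HasDerivAt (fun x : ℝ => (x : ℂ)) 1 x := Complex.ofRealCLM.hasDerivAt
    have h1 : HasDerivAt (fun x : ℝ => -α * ((t - x : ℝ) : ℂ)) α x := by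
      have := (hx.const_sub (t : ℂ)).const_mul (-α)
      simp only [mul_neg, mul_one, neg_neg] at this
      exact this.congr_of_eventuallyEq (Filter.Eventually.of_forall fun y => by push_cast; ring)
    have h2 : HasDerivAt (fun x : ℝ => α * (1 - (x : ℂ))) (-α) x := by
      have := (hx.const_sub (1 : ℂ)).const_mul α
      simpa using this
    have h3 := h1.cexp.mul (((truncExp c).hasDerivAt _).comp x h2)
    refine h3.congr_deriv ?_
    have e := congrArg (eval (α * (1 - (x : ℂ)))) (truncExp_sub_derivative c)
    rw [eval_sub, eval_monomial, mul_pow] at e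
    simp only [Function.comp_apply]
    rw [pow_succ]
    linear_combination (α * Complex.exp (-α * ((t - x : ℝ) : ℂ))) * e
  have hint := intervalIntegral.integral_eq_sub_of_hasDerivAt (a := 0) (b := t)
    (fun x _ => hder x) (Continuous.intervalIntegrable (by fun_prop) _ _)
  rw [intervalIntegral.integral_const_mul] at hint
  have h4 : F t - F 0
      = (truncExp c).eval (α * (1 - t)) - (truncExp c).eval α * Complex.exp (-α * t) := by
    simp only [hF, sub_self, sub_zero, Complex.ofReal_zero, mul_zero, Complex.exp_zero, mul_one,
      one_mul]
    ring
  rw [h4] at hint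
  rw [← hint]
  have := pow_ne_zero (c + 1) hα
  field_simp

theorem integral_one_sub_pow (c : ℕ) (t : ℝ) :
    ∫ x in (0 : ℝ)..t, (1 - (x : ℂ)) ^ c = (1 - (1 - (t : ℂ)) ^ (c + 1)) / ((c : ℂ) + 1) := by
  have h0 : ((c : ℂ) + 1) ≠ 0 := by exact_mod_cast c.succ_ne_zero
  have hder : ∀ x : ℝ, HasDerivAt (fun x : ℝ => -((1 - (x : ℂ)) ^ (c + 1) / ((c : ℂ) + 1)))
      ((1 - (x : ℂ)) ^ c) x := by
    intro x
    have hx : HasDerivAt (fun x : ℝ => (x : ℂ)) 1 x := Complex.ofRealCLM.hasDerivAt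
    have h := (((hx.const_sub 1).pow (c + 1)).div_const ((c : ℂ) + 1)).neg
    refine h.congr_deriv ?_
    push_cast
    field_simp
  rw [intervalIntegral.integral_eq_sub_of_hasDerivAt (fun x _ => hder x)
    (Continuous.intervalIntegrable (by fun_prop) _ _)]
  simp only [Complex.ofReal_zero, sub_zero, one_pow]
  ring

/-- The deviation `∑ e^{-α t} - (m + 1)` of the renewal density, a sum over the zeros `α` of `E_m`,
from its asymptotic value, the reciprocal of the mean `1 / (m + 1)` of the step law. -/
noncomputable def densityDeviation (m : ℕ) (t : ℝ) : ℂ :=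
  ∑ α ∈ expZeros m, Complex.exp (-α * t) - (m + 1)

theorem continuous_densityDeviation (m : ℕ) : Continuous (densityDeviation m) := by
  unfold densityDeviation
  fun_prop

theorem integral_one_sub_pow_mul_densityDeviation (m c : ℕ) (t : ℝ) :
    ∫ x in (0 : ℝ)..t, (1 - (x : ℂ)) ^ c * densityDeviation m (t - x)
      = (∑ α ∈ expZeros m, (c.factorial : ℂ) * (α ^ (c + 1))⁻¹
          * ((truncExp c).eval (α * (1 - t)) - (truncExp c).eval α * Complex.exp (-α * t)))
        - (m + 1) * ((1 - (1 - (t : ℂ)) ^ (c + 1)) / ((c : ℂ) + 1)) := by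
  have e : ∀ x : ℝ, (1 - (x : ℂ)) ^ c * densityDeviation m (t - x)
      = ∑ α ∈ expZeros m, (1 - (x : ℂ)) ^ c * Complex.exp (-α * ((t - x : ℝ) : ℂ))
        - (1 - (x : ℂ)) ^ c * (m + 1) := fun x => by
    rw [densityDeviation, mul_sub, Finset.mul_sum]
  simp only [e]
  rw [intervalIntegral.integral_sub, intervalIntegral.integral_finsetSum,
    intervalIntegral.integral_mul_const, integral_one_sub_pow, mul_comm ((m : ℂ) + 1)]
  · congr 1
    refine Finset.sum_congr rfl fun α hα => ?_
    rw [integral_one_sub_pow_mul_exp c (ne_zero_of_mem_expZeros hα)]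
  · exact fun α _ => Continuous.intervalIntegrable (by fun_prop) _ _
  · exact Continuous.intervalIntegrable (by fun_prop) _ _
  · exact Continuous.intervalIntegrable (by fun_prop) _ _

theorem sum_inv_pow_mul_truncExp_eval (m c : ℕ) (x : ℂ) :
    ∑ α ∈ expZeros m, (α ^ (c + 1))⁻¹ * (truncExp c).eval (α * x)
      = ∑ k ∈ Finset.range (c + 1),
        zeroPowerSum m ((k : ℤ) - (c + 1)) * (x ^ k / (k.factorial : ℂ)) := by
  simp only [truncExp_eval, Finset.mul_sum, zeroPowerSum, Finset.sum_mul]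
  rw [Finset.sum_comm]
  refine Finset.sum_congr rfl fun k _ => Finset.sum_congr rfl fun α hα => ?_
  have e : ((c : ℤ) + 1) = ((c + 1 : ℕ) : ℤ) := by push_cast; ring
  rw [e, zpow_sub₀ (ne_zero_of_mem_expZeros hα), zpow_natCast, zpow_natCast, mul_pow]
  ring

theorem integral_one_sub_pow_self_mul_densityDeviation {m : ℕ} (hm : 1 ≤ m) (t : ℝ) :
    ∫ x in (0 : ℝ)..t, (1 - (x : ℂ)) ^ m * densityDeviation m (t - x)
      = (1 - (1 - (t : ℂ)) ^ m) - (1 - (1 - (t : ℂ)) ^ (m + 1)) := by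
  have hmf : (m.factorial : ℂ) ≠ 0 := by exact_mod_cast m.factorial_ne_zero
  have hm1 : ((m : ℂ) + 1) ≠ 0 := by exact_mod_cast m.succ_ne_zero
  rw [integral_one_sub_pow_mul_densityDeviation]
  have h1 : ∑ α ∈ expZeros m, (m.factorial : ℂ) * (α ^ (m + 1))⁻¹
          * ((truncExp m).eval (α * (1 - t)) - (truncExp m).eval α * Complex.exp (-α * t))
      = (m.factorial : ℂ)
        * ∑ α ∈ expZeros m, (α ^ (m + 1))⁻¹ * (truncExp m).eval (α * (1 - (t : ℂ))) := by
    rw [Finset.mul_sum]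
    refine Finset.sum_congr rfl fun α hα => ?_
    rw [eval_of_mem_expZeros hα]; ring
  have h2 : ∑ α ∈ expZeros m, (α ^ (m + 1))⁻¹ * (truncExp m).eval (α * (1 - (t : ℂ)))
      = 1 / (m.factorial : ℂ) - (1 - (t : ℂ)) ^ m / (m.factorial : ℂ) := by
    rw [sum_inv_pow_mul_truncExp_eval]
    obtain ⟨d, rfl⟩ := Nat.exists_eq_add_of_le' hm
    rw [Finset.sum_range_succ, Finset.sum_range_succ', Finset.sum_eq_zero]
    · have e1 : (((d + 1 : ℕ) : ℤ) - (((d + 1 : ℕ) : ℤ) + 1)) = -1 := by ring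
      have e2 : (((0 : ℕ) : ℤ) - (((d + 1 : ℕ) : ℤ) + 1)) = -(((d + 1 : ℕ) : ℤ) + 1) := by
        push_cast; ring
      rw [e1, e2, zeroPowerSum_neg_one hm, zeroPowerSum_neg_succ hm]
      simp only [pow_zero, Nat.factorial_zero, Nat.cast_one, div_one, mul_one]
      ring
    · intro k hk
      rw [Finset.mem_range] at hk
      rw [zeroPowerSum_eq_zero (by omega) (by omega), zero_mul]
  rw [h1, h2]
  field_simp

theorem integral_one_sub_pow_pred_mul_densityDeviation (d : ℕ) (t : ℝ) :
    ((d : ℂ) + 1) * ∫ x in (0 : ℝ)..t, (1 - (x : ℂ)) ^ d * densityDeviation (d + 1) (t - x)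
      = densityDeviation (d + 1) t + (d + 2) * (1 - (t : ℂ)) ^ (d + 1)
        - (d + 1) * (1 - (t : ℂ)) ^ d := by
  have hmf : (d.factorial : ℂ) ≠ 0 := by exact_mod_cast d.factorial_ne_zero
  have hm1 : ((d : ℂ) + 1) ≠ 0 := by exact_mod_cast d.succ_ne_zero
  rw [integral_one_sub_pow_mul_densityDeviation]
  have h1 : ∑ α ∈ expZeros (d + 1), (d.factorial : ℂ) * (α ^ (d + 1))⁻¹
          * ((truncExp d).eval (α * (1 - t)) - (truncExp d).eval α * Complex.exp (-α * t))
      = (d.factorial : ℂ)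
        * ∑ α ∈ expZeros (d + 1), (α ^ (d + 1))⁻¹ * (truncExp d).eval (α * (1 - (t : ℂ)))
        + ((d : ℂ) + 1)⁻¹ * ∑ α ∈ expZeros (d + 1), Complex.exp (-α * t) := by
    rw [Finset.mul_sum, Finset.mul_sum, ← Finset.sum_add_distrib]
    refine Finset.sum_congr rfl fun α hα => ?_
    have h0 := pow_ne_zero (d + 1) (ne_zero_of_mem_expZeros hα)
    rw [truncExp_pred_eval hα, Nat.factorial_succ]
    push_cast
    field_simp
    ring
  have h2 : ∑ α ∈ expZeros (d + 1), (α ^ (d + 1))⁻¹ * (truncExp d).eval (α * (1 - (t : ℂ)))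
      = - ((1 - (t : ℂ)) ^ d / (d.factorial : ℂ)) := by
    rw [sum_inv_pow_mul_truncExp_eval, Finset.sum_range_succ, Finset.sum_eq_zero]
    · have e1 : ((d : ℤ) - ((d : ℤ) + 1)) = -1 := by ring
      rw [e1, zeroPowerSum_neg_one (by omega)]
      ring
    · intro k hk
      rw [Finset.mem_range] at hk
      rw [zeroPowerSum_eq_zero (by push_cast; omega) (by omega), zero_mul]
  rw [h1, h2, densityDeviation]
  push_cast
  field_simp
  ring

/-- The convolution equation of the deviation. Its kernel `m x (1 - x) ^ (m - 1)` has total mass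
only `1 / (m + 1)` on `[0, 1]`, unlike the step density `m (1 - x) ^ (m - 1)`; it arises by
applying `d/dt + m` to the renewal equation with the tail `(1 - x) ^ m` as kernel. -/
theorem densityDeviation_eq {m : ℕ} (hm : 1 ≤ m) (t : ℝ) :
    densityDeviation m t
      = (∫ x in (0 : ℝ)..t, ((m * x * (1 - x) ^ (m - 1) : ℝ) : ℂ) * densityDeviation m (t - x))
        + ((-(1 - t) ^ m + m * t ^ 2 * (1 - t) ^ (m - 1) : ℝ) : ℂ) := by
  obtain ⟨d, rfl⟩ := Nat.exists_eq_add_of_le' hm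
  have hcont := continuous_densityDeviation (d + 1)
  have h1 : ∫ x in (0 : ℝ)..t, (((d + 1 : ℕ) * x * (1 - x) ^ (d + 1 - 1) : ℝ) : ℂ)
        * densityDeviation (d + 1) (t - x)
      = ((d : ℂ) + 1) * (∫ x in (0 : ℝ)..t, (1 - (x : ℂ)) ^ d * densityDeviation (d + 1) (t - x))
        - ((d : ℂ) + 1)
          * ∫ x in (0 : ℝ)..t, (1 - (x : ℂ)) ^ (d + 1) * densityDeviation (d + 1) (t - x) := by
    rw [← intervalIntegral.integral_const_mul, ← intervalIntegral.integral_const_mul,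
      ← intervalIntegral.integral_sub]
    · refine intervalIntegral.integral_congr fun x _ => ?_
      simp only [Nat.add_sub_cancel]
      push_cast
      ring
    · exact Continuous.intervalIntegrable (by fun_prop) _ _
    · exact Continuous.intervalIntegrable (by fun_prop) _ _
  rw [h1, integral_one_sub_pow_pred_mul_densityDeviation,
    integral_one_sub_pow_self_mul_densityDeviation hm, Nat.add_sub_cancel]
  push_cast
  ring

/-- The renewal value minus its two-term asymptotics, as a moment of the deviation. -/
theorem integral_moment_densityDeviation {m : ℕ} (hm : 1 ≤ m) :
    ∫ x in (0 : ℝ)..1, (1 - (x : ℂ)) ^ (m + 1) * densityDeviation m (1 - x)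
      = renewalValue m - 1 - ((m : ℂ) + 1 - 1 / ((m : ℂ) + 2)) := by
  have hm2 : ((m : ℂ) + 2) ≠ 0 := by exact_mod_cast (m + 1).succ_ne_zero
  have hm1 : ((m : ℂ) + 1) ≠ 0 := by exact_mod_cast m.succ_ne_zero
  have hmf : (m.factorial : ℂ) ≠ 0 := by exact_mod_cast m.factorial_ne_zero
  rw [integral_one_sub_pow_mul_densityDeviation]
  have h1 : ∑ α ∈ expZeros m, ((m + 1).factorial : ℂ) * (α ^ (m + 1 + 1))⁻¹
          * ((truncExp (m + 1)).eval (α * (1 - (1 : ℝ)))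
            - (truncExp (m + 1)).eval α * Complex.exp (-α * (1 : ℝ)))
      = ((m + 1).factorial : ℂ) * zeroPowerSum m (-(m + 2)) + renewalValue m := by
    rw [zeroPowerSum, renewalValue, Finset.mul_sum, ← Finset.sum_neg_distrib,
      ← Finset.sum_add_distrib]
    refine Finset.sum_congr rfl fun α hα => ?_
    have h0 := ne_zero_of_mem_expZeros hα
    have h2 : (truncExp (m + 1)).eval 0 = 1 := by
      rw [← coeff_zero_eq_eval_zero, truncExp_coeff]; simp
    have h3 : α ^ (-((m : ℤ) + 2)) = (α ^ (m + 1 + 1))⁻¹ := by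
      rw [zpow_neg]; congr 1
    have h4 : ((m + 1).factorial : ℂ) ≠ 0 := by exact_mod_cast Nat.factorial_ne_zero _
    rw [Complex.ofReal_one, sub_self, mul_zero, h2, truncExp_succ_eval, eval_of_mem_expZeros hα,
      zero_add, h3, mul_one]
    field_simp
    ring
  rw [h1, zeroPowerSum_neg_succ_succ hm, Complex.ofReal_one, sub_self, Nat.factorial_succ]
  push_cast
  rw [show (m : ℂ) + 1 + 1 = m + 2 by ring]
  field_simp
  ring

/-! ### Exponential smallness of the deviation -/

/-- At rate `m / 2` the kernel is dominated by a function of integral at most `64 / m`. -/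
theorem kernel_le {m : ℕ} (hm : 4 ≤ m) {x : ℝ} (h0 : 0 ≤ x) (h1 : x ≤ 1) :
    m * x * (1 - x) ^ (m - 1) ≤ 8 * Real.exp (-(m / 8 * x)) * Real.exp (-(m / 2 * x)) := by
  have hm' : (4 : ℝ) ≤ m := by exact_mod_cast hm
  have e1 : (1 - x) ^ (m - 1) ≤ Real.exp (-((m - 1 : ℝ) * x)) := by
    have := pow_le_pow_left₀ (by linarith : 0 ≤ 1 - x) (Real.one_sub_le_exp_neg x) (m - 1)
    rw [← Real.exp_nat_mul] at this
    refine this.trans (le_of_eq ?_)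
    rw [Nat.cast_sub (by omega)]; push_cast; congr 1; ring
  have e2 : m / 8 * x ≤ Real.exp (m / 8 * x) := by
    linarith [Real.add_one_le_exp ((m : ℝ) / 8 * x)]
  calc m * x * (1 - x) ^ (m - 1)
      = 8 * (m / 8 * x) * (1 - x) ^ (m - 1) := by ring
    _ ≤ 8 * Real.exp (m / 8 * x) * Real.exp (-((m - 1 : ℝ) * x)) := by gcongr
    _ = 8 * Real.exp (m / 8 * x + -((m - 1 : ℝ) * x)) := by rw [mul_assoc, ← Real.exp_add]
    _ ≤ 8 * Real.exp (-(m / 8 * x) + -(m / 2 * x)) := by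
        refine mul_le_mul_of_nonneg_left (Real.exp_le_exp.mpr ?_) (by norm_num)
        nlinarith
    _ = _ := by rw [mul_assoc, ← Real.exp_add]

theorem inhomogeneity_le {m : ℕ} (hm : 64 ≤ m) {t : ℝ} (h0 : 0 ≤ t) (h1 : t ≤ 1) :
    |(-(1 - t) ^ m + m * t ^ 2 * (1 - t) ^ (m - 1))| ≤ 2 * Real.exp (-(m / 2 * t)) := by
  have hm' : (64 : ℝ) ≤ m := by exact_mod_cast hm
  have hpow : ∀ k : ℕ, (1 - t) ^ k ≤ Real.exp (-(k * t)) := by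
    intro k
    have := pow_le_pow_left₀ (by linarith : 0 ≤ 1 - t) (Real.one_sub_le_exp_neg t) k
    rw [← Real.exp_nat_mul] at this
    exact this.trans (le_of_eq (by congr 1; ring))
  have e1 : (1 - t) ^ m ≤ Real.exp (-(m / 2 * t)) :=
    (hpow m).trans (Real.exp_le_exp.mpr (by nlinarith))
  have e2 : t ≤ 8 / m * Real.exp (m / 8 * t) := by
    have := Real.add_one_le_exp ((m : ℝ) / 8 * t)
    rw [div_mul_eq_mul_div, le_div_iff₀ (by linarith)]
    nlinarith
  have e3 : m * t ^ 2 * (1 - t) ^ (m - 1) ≤ Real.exp (-(m / 2 * t)) := by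
    have e4 := hpow (m - 1)
    rw [Nat.cast_sub (by omega), Nat.cast_one] at e4
    calc m * t ^ 2 * (1 - t) ^ (m - 1)
        ≤ m * (8 / m * Real.exp (m / 8 * t)) ^ 2 * Real.exp (-((m - 1) * t)) := by gcongr
      _ = 64 / m * (Real.exp (m / 8 * t) * Real.exp (m / 8 * t) * Real.exp (-((m - 1) * t))) := by
          field_simp; ring
      _ = 64 / m * Real.exp (m / 8 * t + m / 8 * t + -((m - 1) * t)) := by
          rw [Real.exp_add, Real.exp_add]
      _ ≤ 1 * Real.exp (-(m / 2 * t)) := by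
          gcongr
          · rw [div_le_one (by linarith)]; exact hm'
          · nlinarith
      _ = _ := one_mul _
  have p0 : 0 ≤ 1 - t := by linarith
  have p1 : 0 ≤ (1 - t) ^ m := by positivity
  have p2 : 0 ≤ m * t ^ 2 * (1 - t) ^ (m - 1) := by positivity
  rw [abs_le]
  constructor <;> linarith

/-- The convolution equation is a contraction in the sup norm with weight `e^{m t / 2}`. -/
theorem norm_densityDeviation_le {m : ℕ} (hm : 128 ≤ m) {t : ℝ} (ht : t ∈ Set.Icc (0 : ℝ) 1) :
    ‖densityDeviation m t‖ ≤ 4 * Real.exp (-(m / 2 * t)) := by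
  have hm' : (128 : ℝ) ≤ m := by exact_mod_cast hm
  have hcont := continuous_densityDeviation m
  obtain ⟨s, hs, hmax⟩ := isCompact_Icc.exists_isMaxOn (Set.nonempty_Icc.mpr zero_le_one)
    (f := fun t : ℝ => ‖densityDeviation m t‖ * Real.exp (m / 2 * t))
    (Continuous.continuousOn (by fun_prop))
  set B := ‖densityDeviation m s‖ * Real.exp (m / 2 * s) with hB
  have hB0 : 0 ≤ B := by positivity
  have hle : ∀ x ∈ Set.Icc (0 : ℝ) 1,
      ‖densityDeviation m x‖ ≤ B * Real.exp (-(m / 2 * x)) := by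
    intro x hx
    rw [Real.exp_neg, ← div_eq_mul_inv, le_div_iff₀ (Real.exp_pos _)]
    exact hmax hx
  have hconv : ‖∫ x in (0 : ℝ)..s,
      ((m * x * (1 - x) ^ (m - 1) : ℝ) : ℂ) * densityDeviation m (s - x)‖
      ≤ B / 2 * Real.exp (-(m / 2 * s)) := by
    have h1 : ‖∫ x in (0 : ℝ)..s,
        ((m * x * (1 - x) ^ (m - 1) : ℝ) : ℂ) * densityDeviation m (s - x)‖
        ≤ ∫ x in (0 : ℝ)..s, 8 * B * Real.exp (-(m / 2 * s)) * Real.exp (-(m / 8) * x) := by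
      refine intervalIntegral.norm_integral_le_of_norm_le hs.1 ?_
        (Continuous.intervalIntegrable (by fun_prop) _ _)
      refine Filter.Eventually.of_forall fun x hx => ?_
      have hx0 : 0 ≤ x := hx.1.le
      have hx1 : x ≤ 1 := hx.2.trans hs.2
      have hx2 : s - x ∈ Set.Icc (0 : ℝ) 1 := ⟨by linarith [hx.2], by linarith [hs.2]⟩
      have hp : 0 ≤ m * x * (1 - x) ^ (m - 1) := by
        have : 0 ≤ 1 - x := by linarith
        positivity
      rw [norm_mul, Complex.norm_real, Real.norm_of_nonneg hp]
      calc _ ≤ (8 * Real.exp (-(m / 8 * x)) * Real.exp (-(m / 2 * x)))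
            * (B * Real.exp (-(m / 2 * (s - x)))) :=
            mul_le_mul (kernel_le (by omega) hx0 hx1) (hle _ hx2) (norm_nonneg _) (by positivity)
        _ = 8 * B * (Real.exp (-(m / 2 * x)) * Real.exp (-(m / 2 * (s - x))))
            * Real.exp (-(m / 8 * x)) := by ring
        _ = _ := by rw [← Real.exp_add]; congr 2 <;> ring_nf
    refine h1.trans ?_
    have hint : ∫ x in (0 : ℝ)..s, Real.exp (-(m / 8) * x) ≤ 1 / 16 := by
      have hne : (-((m : ℝ) / 8)) ≠ 0 := by
        have : (0 : ℝ) < m / 8 := by linarith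
        linarith
      rw [intervalIntegral.integral_comp_mul_left (fun y => Real.exp y) hne, integral_exp,
        mul_zero, Real.exp_zero, smul_eq_mul]
      have h8 : (-((m : ℝ) / 8))⁻¹ * (Real.exp (-(m / 8) * s) - 1)
          = (1 - Real.exp (-(m / 8) * s)) / (m / 8) := by
        rw [inv_neg]; field_simp; ring
      rw [h8, div_le_iff₀ (by linarith)]
      linarith [Real.exp_pos (-((m : ℝ) / 8) * s)]
    rw [intervalIntegral.integral_const_mul]
    calc _ ≤ 8 * B * Real.exp (-(m / 2 * s)) * (1 / 16) := by gcongr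
      _ = _ := by ring
  have hBle : B ≤ B / 2 + 2 := by
    have h1 : ‖densityDeviation m s‖ ≤ (B / 2 + 2) * Real.exp (-(m / 2 * s)) := by
      rw [densityDeviation_eq (by omega) s]
      refine (norm_add_le _ _).trans ?_
      rw [add_mul]
      refine add_le_add hconv ?_
      rw [Complex.norm_real, Real.norm_eq_abs]
      exact inhomogeneity_le (by omega) hs.1 hs.2
    rw [Real.exp_neg, ← div_eq_mul_inv, le_div_iff₀ (Real.exp_pos _)] at h1
    exact h1
  refine (hle t ht).trans ?_
  gcongr
  linarith

theorem norm_renewalValue_sub_le {m : ℕ} (hm : 128 ≤ m) :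
    ‖renewalValue m - 1 - ((m : ℂ) + 1 - 1 / ((m : ℂ) + 2))‖ ≤ 4 * Real.exp (-(1 / 2) * m) := by
  rw [← integral_moment_densityDeviation (by omega)]
  have h : ∀ x ∈ Set.uIoc (0 : ℝ) 1,
      ‖(1 - (x : ℂ)) ^ (m + 1) * densityDeviation m (1 - x)‖ ≤ 4 * Real.exp (-(1 / 2) * m) := by
    intro x hx
    rw [Set.uIoc_of_le zero_le_one] at hx
    have h0 : 0 ≤ 1 - x := by linarith [hx.2]
    have h1 : 1 - x ≤ 1 := by linarith [hx.1]
    have e : (1 - (x : ℂ)) = ((1 - x : ℝ) : ℂ) := by push_cast; ring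
    rw [e, norm_mul, norm_pow, Complex.norm_real, Real.norm_of_nonneg h0]
    have h2 : (1 - x) ^ (m + 1) ≤ Real.exp (-(1 / 2 * m * x)) := by
      calc (1 - x) ^ (m + 1) ≤ (1 - x) ^ m := pow_le_pow_of_le_one h0 h1 (by omega)
        _ ≤ (Real.exp (-x)) ^ m := pow_le_pow_left₀ h0 (Real.one_sub_le_exp_neg x) m
        _ = Real.exp (m * -x) := (Real.exp_nat_mul _ _).symm
        _ ≤ _ := by
          apply Real.exp_le_exp.mpr
          have : 0 ≤ (m : ℝ) * x := mul_nonneg (Nat.cast_nonneg _) hx.1.le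
          linarith
    calc _ ≤ Real.exp (-(1 / 2 * m * x)) * (4 * Real.exp (-(m / 2 * (1 - x)))) :=
          mul_le_mul h2 (norm_densityDeviation_le hm ⟨h0, h1⟩) (norm_nonneg _) (by positivity)
      _ = 4 * (Real.exp (-(1 / 2 * m * x)) * Real.exp (-(m / 2 * (1 - x)))) := by ring
      _ = _ := by rw [← Real.exp_add]; congr 2; ring
  have := intervalIntegral.norm_integral_le_of_norm_le_const h
  simpa using this

/-! ### The limit of the expectations -/

theorem ofReal_re_renewalValue_sub_one {m : ℕ} (hm : 1 ≤ m) :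
    (((renewalValue m - 1).re : ℝ) : ℂ) = renewalValue m - 1 := by
  have h := (Complex.continuous_im.tendsto _).comp (tendsto_expectedL1 hm)
  have him : (renewalValue m - 1).im = 0 :=
    tendsto_nhds_unique h (by simp [Function.comp_def])
  exact Complex.ext (by simp) (by rw [him]; simp)

/-- The two-term asymptotics for all `m`; the constant absorbs the finitely many small `m`. -/
theorem exists_abs_re_renewalValue_sub_le :
    ∃ C : ℝ, ∀ m : ℕ, |(renewalValue m - 1).re - ((m : ℝ) + 1 - 1 / ((m : ℝ) + 2))|
      ≤ C * Real.exp (-(1 / 2) * (m : ℝ)) := by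
  set D : ℕ → ℝ := fun m => |(renewalValue m - 1).re - ((m : ℝ) + 1 - 1 / ((m : ℝ) + 2))| with hD
  have hS : ∀ m, 0 ≤ D m * Real.exp (1 / 2 * m) := fun m => by positivity
  refine ⟨4 + ∑ k ∈ Finset.range 128, D k * Real.exp (1 / 2 * k), fun m => ?_⟩
  rcases lt_or_ge m 128 with hm | hm
  · have h1 := Finset.single_le_sum (f := fun k : ℕ => D k * Real.exp (1 / 2 * k))
      (fun k _ => hS k) (Finset.mem_range.mpr hm)
    have h2 : D m = D m * Real.exp (1 / 2 * m) * Real.exp (-(1 / 2) * m) := by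
      rw [mul_assoc, ← Real.exp_add]; simp
    calc D m = D m * Real.exp (1 / 2 * m) * Real.exp (-(1 / 2) * m) := h2
      _ ≤ _ := by
        gcongr
        exact h1.trans (by linarith)
  · have h1 := (Complex.abs_re_le_norm _).trans (norm_renewalValue_sub_le hm)
    have h2 : (renewalValue m - 1 - ((m : ℂ) + 1 - 1 / ((m : ℂ) + 2))).re
        = (renewalValue m - 1).re - ((m : ℝ) + 1 - 1 / ((m : ℝ) + 2)) := by
      have e : ((m : ℂ) + 1 - 1 / ((m : ℂ) + 2)) = (((m : ℝ) + 1 - 1 / ((m : ℝ) + 2) : ℝ) : ℂ) := by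
        push_cast; ring
      rw [e, Complex.sub_re (renewalValue m - 1), Complex.ofReal_re]
    rw [h2] at h1
    refine h1.trans ?_
    gcongr
    linarith [Finset.sum_nonneg fun k (_ : k ∈ Finset.range 128) => hS k]

theorem theorem1p1 :
    ∃ 𝓛 : ℕ → ℝ,
      -- (a) for every `m ≥ 1` the limit exists and is given by the zeros of `E_m`
      (∀ m : ℕ, 1 ≤ m →
        Filter.Tendsto (fun n : ℕ => expectedL1 m n) Filter.atTop (nhds (𝓛 m)) ∧
        (𝓛 m : ℂ) = -1 - ((truncExp m).roots.map fun α : ℂ => α⁻¹ * Complex.exp (-α)).sum) ∧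
      -- (b) exponentially precise estimate, with absolute constants
      (∃ β : ℝ, 0 < β ∧ ∃ C : ℝ, ∀ m : ℕ, 1 ≤ m →
        |𝓛 m - ((m : ℝ) + 1 - 1 / ((m : ℝ) + 2))| ≤ C * Real.exp (-β * (m : ℝ))) ∧
      -- the conjecture: the expectation is asymptotic to `m`, for `n` large in terms of `m`
      (∀ ε : ℝ, 0 < ε → ∃ M : ℕ, ∀ m : ℕ, M ≤ m → ∃ N : ℕ, ∀ n : ℕ, N ≤ n →
        |expectedL1 m n / (m : ℝ) - 1| ≤ ε) := by
  have hlim : ∀ m : ℕ, 1 ≤ m → Filter.Tendsto (fun n : ℕ => expectedL1 m n) Filter.atTop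
      (nhds (renewalValue m - 1).re) := fun m hm =>
    ((Complex.continuous_re.tendsto _).comp (tendsto_expectedL1 hm)).congr fun n => by simp
  obtain ⟨C, hC⟩ := exists_abs_re_renewalValue_sub_le
  refine ⟨fun m => (renewalValue m - 1).re, fun m hm => ⟨hlim m hm, ?_⟩,
    ⟨1 / 2, by norm_num, C, fun m _ => hC m⟩, fun ε hε => ?_⟩
  · rw [ofReal_re_renewalValue_sub_one hm, sum_roots_truncExp, renewalValue]
    ring
  -- The limit differs from `m` by at most `1 + |C|`, the expectation from the limit by at most `1`.
  · obtain ⟨M, hM⟩ := exists_nat_ge ((2 + |C|) / ε)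
    refine ⟨M + 1, fun m hm => ?_⟩
    have hm0 : (0 : ℝ) < m := by exact_mod_cast (by omega : 0 < m)
    obtain ⟨N, hN⟩ := Metric.tendsto_atTop.mp (hlim m (by omega)) 1 one_pos
    refine ⟨N, fun n hn => ?_⟩
    have h1 := hN n hn
    rw [Real.dist_eq] at h1
    have h2 := hC m
    have h3 : C * Real.exp (-(1 / 2) * (m : ℝ)) ≤ |C| := by
      have he : Real.exp (-(1 / 2) * (m : ℝ)) ≤ 1 := Real.exp_le_one_iff.mpr (by linarith)
      calc C * Real.exp (-(1 / 2) * (m : ℝ)) ≤ |C| * Real.exp (-(1 / 2) * (m : ℝ)) := by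
            gcongr; exact le_abs_self C
        _ ≤ |C| * 1 := by gcongr
        _ = |C| := mul_one _
    have h4 : 0 ≤ 1 / ((m : ℝ) + 2) := by positivity
    have h5 : 1 / ((m : ℝ) + 2) ≤ 1 := by
      rw [div_le_one (by linarith)]; linarith
    have h6 : |expectedL1 m n - m| ≤ 2 + |C| := by
      rw [abs_lt] at h1
      have h7 := abs_le.mp (h2.trans h3)
      rw [abs_le]
      constructor <;> linarith [h1.1, h1.2, h7.1, h7.2]
    have h8 : (2 + |C|) ≤ ε * m := by
      have : (2 + |C|) / ε ≤ m := hM.trans (by exact_mod_cast (by omega : M ≤ m))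
      rw [div_le_iff₀ hε] at this
      linarith
    rw [div_sub_one hm0.ne', abs_div, abs_of_pos hm0, div_le_iff₀ hm0]
    exact h6.trans h8
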